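/- Call a compact set $L\subset\mathbb C$ a Swiss cheese if $L=\overline D\setminus\bigcup_{j=1}^\infty D_j$, where $\overline D$ is the closed unit disc and $\{D_j\}_{j=1}^\infty$ is a sequence of open discs contained in the open unit disc $D$, with pairwise disjoint closures and with radii $r_j>0$ satisfying $\sum_{j=1}^\infty r_j<\infty$, and $L$ has empty interior. For a compact set $K\subset\mathbb C$, let $R(K)$ be the closure, in the supremum norm on $K$, of the algebra of (restrictions to $K$ of) rational functions holomorphic on a neighborhood of $K$. The Gleason parts for $R(K)$ are the equivalence classes in the maximal ideal space of $R(K)$ (the set of nonzero multiplicative linear functionals on $R(K)$) under the equivalence relation $\varphi\sim\psi$ if $\|\varphi-\psi\|<2$ in the norm of the dual space $R(K)^*$; a point $z\in K$ is identified with the functional $f\mapsto f(z)$. Theorem. There exists a Swiss cheese $L$ such that $[0,1)\subset L$ and $[0,1)$ is contained in a single Gleason part for $R(L)$. -/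

import Mathlib

/-- A *Swiss cheese*: a set `L` obtained from the closed unit disc of `ℂ` by deleting a sequence of
(nondegenerate) open discs contained in the open unit disc, with pairwise disjoint closures and
summable radii, such that `L` has empty interior. -/
def IsSwissCheese (L : Set ℂ) : Prop :=
  ∃ (c : ℕ → ℂ) (r : ℕ → ℝ),
    (∀ j, 0 < r j) ∧
    (∀ j, Metric.ball (c j) (r j) ⊆ Metric.ball 0 1) ∧
    (∀ i j, i ≠ j →
      Disjoint (Metric.closedBall (c i) (r i)) (Metric.closedBall (c j) (r j))) ∧
    Summable r ∧
    L = Metric.closedBall 0 1 \ ⋃ j, Metric.ball (c j) (r j) ∧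
    interior L = ∅

/-- The subalgebra of `C(K)` consisting of the restrictions to `K` of the rational functions `p / q`
whose denominator has no zero on `K`, i.e. of the rational functions that are holomorphic on a
neighbourhood of `K`. -/
noncomputable def rationalSubalgebra (K : TopologicalSpace.Compacts ℂ) : Subalgebra ℂ C(K, ℂ) where
  carrier := {f | ∃ p q : Polynomial ℂ,
    (∀ z ∈ K, q.eval z ≠ 0) ∧ ∀ z : K, f z = p.eval (z : ℂ) / q.eval (z : ℂ)}
  mul_mem' := by
    rintro f g ⟨p, q, hq, hf⟩ ⟨p', q', hq', hg⟩
    refine ⟨p * p', q * q', fun z hz => ?_, fun z => ?_⟩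
    · rw [Polynomial.eval_mul]
      exact mul_ne_zero (hq z hz) (hq' z hz)
    · rw [ContinuousMap.mul_apply, hf z, hg z, Polynomial.eval_mul, Polynomial.eval_mul,
        div_mul_div_comm]
  add_mem' := by
    rintro f g ⟨p, q, hq, hf⟩ ⟨p', q', hq', hg⟩
    refine ⟨p * q' + q * p', q * q', fun z hz => ?_, fun z => ?_⟩
    · rw [Polynomial.eval_mul]
      exact mul_ne_zero (hq z hz) (hq' z hz)
    · rw [ContinuousMap.add_apply, hf z, hg z, div_add_div _ _ (hq z z.2) (hq' z z.2)]
      simp only [Polynomial.eval_add, Polynomial.eval_mul]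
  algebraMap_mem' := by
    intro a
    exact ⟨Polynomial.C a, 1, fun z _ => by simp, fun z => by simp⟩

/-- The uniform algebra `R(K)`: the closure, in `C(K)` with the supremum norm, of the rational
functions holomorphic on a neighbourhood of the compact set `K ⊆ ℂ`. -/
noncomputable def rationalAlgebra (K : TopologicalSpace.Compacts ℂ) : Subalgebra ℂ C(K, ℂ) :=
  (rationalSubalgebra K).topologicalClosure

/-- Evaluation at the point `x` of `K`, as a point of the maximal ideal space (the space of
characters) of an algebra `A` of continuous functions on `K`. -/
noncomputable def evalChar {K : Type*} [TopologicalSpace K] [CompactSpace K] (A : Subalgebra ℂ C(K, ℂ)) (x : K) :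
    WeakDual.characterSpace ℂ A :=
  ⟨StrongDual.toWeakDual ((ContinuousMap.evalCLM ℂ x).comp A.toSubmodule.subtypeL), by
    rw [WeakDual.CharacterSpace.eq_set_map_one_map_mul]
    exact ⟨rfl, fun _ _ => rfl⟩⟩

/-- The relation `‖φ - ψ‖ < 2`, with the norm of the dual space `A*`, on the maximal ideal space of
an algebra `A` of continuous functions on a compact space. -/
def GleasonRel {K : Type*} [TopologicalSpace K] [CompactSpace K] (A : Subalgebra ℂ C(K, ℂ))
    (φ ψ : WeakDual.characterSpace ℂ A) : Prop :=
  ‖WeakDual.toStrongDual (φ : WeakDual ℂ A) - WeakDual.toStrongDual (ψ : WeakDual ℂ A)‖ < 2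

/-- The *Gleason parts* of `A`: the classes of the relation `‖φ - ψ‖ < 2` on the maximal ideal space
(for uniform algebras this is an equivalence relation). -/
def IsGleasonPart {K : Type*} [TopologicalSpace K] [CompactSpace K] (A : Subalgebra ℂ C(K, ℂ))
    (P : Set (WeakDual.characterSpace ℂ A)) : Prop :=
  ∃ φ : WeakDual.characterSpace ℂ A, P = {ψ | GleasonRel A φ ψ}

open Metric Polynomial

/-! The holes are chosen so small, relative to their distance from the unit circle and from `[0,
1]`, that on these two sets every rational function in the algebra is nearly holomorphic in the
whole disc. By partial fractions such an `f` equals there a function `F` holomorphic in the disc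
minus Cauchy integrals over finitely many hole boundaries (`exists_isSplit_div`). If `|f| ≤ 1`,
these integrals total at most `1/10` (`exists_approx`).

The maximum principle and the Schwarz lemma for `F` then show that an `f` vanishing at `x` stays
below `9/10` at nearby `y`. A Cayley transform turns this into a Harnack inequality with constant 19
(`re_le_of_near`). Chaining along points approaching 1 gives constant `19 ^ n` on `[0, 1 - 2⁻ⁿ]`,
and applying it to `‖f‖ + u f` with `|u| = 1` bounds the distance between evaluations at `0` and `y`
by `2 (1 - 19⁻ⁿ) < 2`.

Holes are centred at points of a dense sequence whenever possible, so the interior is empty. -/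

/-- The union of the unit circle and the segment `[0, 1]`. -/
def slitCircle : Set ℂ := sphere 0 1 ∪ (fun t : ℝ => (t : ℂ)) '' Set.Icc 0 1

/-- The closed unit disc with the open discs `ball (c j) (r j)` deleted. -/
def cheese (c : ℕ → ℂ) (r : ℕ → ℝ) : Set ℂ := closedBall 0 1 \ ⋃ j, ball (c j) (r j)

/-- Discs with disjoint closures in the unit disc, whose radii are small compared with the distance
of the centres to the unit circle and to `[0, 1]`. -/
structure FarDiscs (c : ℕ → ℂ) (r : ℕ → ℝ) : Prop where
  pos : ∀ j, 0 < r j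
  subset : ∀ j, ball (c j) (r j) ⊆ ball 0 1
  disjoint : ∀ i j, i ≠ j → Disjoint (closedBall (c i) (r i)) (closedBall (c j) (r j))
  far : ∀ j, ∀ z ∈ slitCircle, r j * (20 * 2 ^ j + 1) ≤ ‖z - c j‖

lemma slitCircle_subset_closedBall : slitCircle ⊆ closedBall (0 : ℂ) 1 := by
  rintro z (hz | ⟨t, ht, rfl⟩)
  · exact sphere_subset_closedBall hz
  · simpa [abs_of_nonneg ht.1] using ht.2

/-! ### Elementary geometry of the holes. -/

namespace FarDiscs

variable {c : ℕ → ℂ} {r : ℕ → ℝ}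

lemma closedBall_subset (h : FarDiscs c r) (j : ℕ) :
    closedBall (c j) (r j) ⊆ closedBall 0 1 := by
  rw [← closure_ball (c j) (h.pos j).ne', ← closure_ball (0 : ℂ) one_ne_zero]
  exact closure_mono (h.subset j)

lemma far_sub (h : FarDiscs c r) (j : ℕ) {z : ℂ} (hz : z ∈ slitCircle) :
    r j * (20 * 2 ^ j) ≤ ‖z - c j‖ - r j := by
  have := h.far j z hz
  linarith

lemma lt_norm (h : FarDiscs c r) (j : ℕ) {z : ℂ} (hz : z ∈ slitCircle) : r j < ‖z - c j‖ := by
  have h1 := h.far_sub j hz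
  have h2 : 0 < r j * (20 * 2 ^ j) := mul_pos (h.pos j) (by positivity)
  linarith

lemma notMem_closedBall (h : FarDiscs c r) (j : ℕ) {z : ℂ} (hz : z ∈ slitCircle) :
    z ∉ closedBall (c j) (r j) := by
  rw [mem_closedBall, dist_eq_norm, not_le]
  exact h.lt_norm j hz

lemma slitCircle_subset (h : FarDiscs c r) : slitCircle ⊆ cheese c r := fun z hz =>
  ⟨slitCircle_subset_closedBall hz, by
    simp only [Set.mem_iUnion, not_exists]
    exact fun j hj => h.notMem_closedBall j hz (ball_subset_closedBall hj)⟩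

lemma sphere_subset (h : FarDiscs c r) (j : ℕ) : sphere (c j) (r j) ⊆ cheese c r := by
  intro z hz
  refine ⟨h.closedBall_subset j (sphere_subset_closedBall hz), ?_⟩
  simp only [Set.mem_iUnion, not_exists]
  intro i hi
  by_cases hij : i = j
  · subst hij
    rw [mem_ball, mem_sphere.1 hz] at hi
    exact lt_irrefl _ hi
  · exact Set.disjoint_left.1 (h.disjoint i j hij) (ball_subset_closedBall hi)
      (sphere_subset_closedBall hz)

/-- Testing `far` at the point 0, with centres in the closed unit disc, gives `r j ≤ 2⁻ʲ`. -/
lemma summable (h : FarDiscs c r) : Summable r := by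
  refine Summable.of_nonneg_of_le (fun j => (h.pos j).le) (fun j => ?_) summable_geometric_two
  have h0 : (0 : ℂ) ∈ slitCircle := Or.inr ⟨0, by simp, by simp⟩
  have h1 := h.far j 0 h0
  have h2 : ‖c j‖ ≤ 1 := by
    simpa using h.closedBall_subset j (mem_closedBall_self (h.pos j).le)
  rw [zero_sub, norm_neg] at h1
  have h3 : r j * 2 ^ j ≤ 1 := by
    have : 0 ≤ r j * (19 * 2 ^ j) := mul_nonneg (h.pos j).le (by positivity)
    have := h.pos j
    linarith
  rw [one_div, inv_pow, ← one_div, le_div_iff₀ (by positivity)]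
  exact h3

/-! ### Splitting rational functions by partial fractions. -/

/-- On the unit circle and on `[0, 1]`, the function `f` differs from a function holomorphic in the
unit disc by its Cauchy integrals over the boundaries of the deleted discs of index in `S`. -/
def IsSplit (c : ℕ → ℂ) (r : ℕ → ℝ) (S : Finset ℕ) (f : ℂ → ℂ) : Prop :=
  (∀ j ∈ S, ContinuousOn f (sphere (c j) (r j))) ∧
    ∃ F : ℂ → ℂ, DiffContOnCl ℂ F (ball 0 1) ∧ ∀ z ∈ slitCircle,
      f z = F z - ∑ j ∈ S, (2 * Real.pi * Complex.I)⁻¹ * ∮ ζ in C(c j, r j), f ζ * (ζ - z)⁻¹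

variable {S : Finset ℕ} {f g : ℂ → ℂ}

lemma IsSplit.congr (h : FarDiscs c r) (hf : IsSplit c r S f)
    (hfg : Set.EqOn g f (cheese c r)) : IsSplit c r S g := by
  obtain ⟨hc, F, hF, hE⟩ := hf
  refine ⟨fun j hj => (hc j hj).congr (hfg.mono (h.sphere_subset j)), F, hF, fun z hz => ?_⟩
  rw [hfg (h.slitCircle_subset hz), hE z hz]
  congr 1
  refine Finset.sum_congr rfl fun j _ => ?_
  congr 1
  refine circleIntegral.integral_congr (h.pos j).le fun ζ hζ => ?_
  simp only [hfg (h.sphere_subset j hζ)]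

lemma continuousOn_inv_sub (h : FarDiscs c r) (j : ℕ) {z : ℂ} (hz : z ∈ slitCircle) :
    ContinuousOn (fun ζ => (ζ - z)⁻¹) (closedBall (c j) (r j)) := by
  refine ContinuousOn.inv₀ (by fun_prop) fun ζ hζ h0 => ?_
  rw [sub_eq_zero.1 h0] at hζ
  exact h.notMem_closedBall j hz hζ

lemma circleIntegrable (h : FarDiscs c r) (hf : IsSplit c r S f) {j : ℕ} (hj : j ∈ S) {z : ℂ}
    (hz : z ∈ slitCircle) : CircleIntegrable (fun ζ => f ζ * (ζ - z)⁻¹) (c j) (r j) :=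
  ((hf.1 j hj).mul ((h.continuousOn_inv_sub j hz).mono sphere_subset_closedBall)).circleIntegrable
    (h.pos j).le

lemma IsSplit.add (h : FarDiscs c r) (hf : IsSplit c r S f) (hg : IsSplit c r S g) :
    IsSplit c r S (fun z => f z + g z) := by
  obtain ⟨F, hF, hE⟩ := hf.2
  obtain ⟨G, hG, hE'⟩ := hg.2
  refine ⟨fun j hj => (hf.1 j hj).add (hg.1 j hj), fun z => F z + G z, hF.add hG, fun z hz => ?_⟩
  have : ∀ j ∈ S, (2 * Real.pi * Complex.I)⁻¹ * (∮ ζ in C(c j, r j), (f ζ + g ζ) * (ζ - z)⁻¹) =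
      (2 * Real.pi * Complex.I)⁻¹ * (∮ ζ in C(c j, r j), f ζ * (ζ - z)⁻¹) +
      (2 * Real.pi * Complex.I)⁻¹ * (∮ ζ in C(c j, r j), g ζ * (ζ - z)⁻¹) := by
    intro j hj
    simp only [add_mul]
    rw [circleIntegral.integral_add (h.circleIntegrable hf hj hz) (h.circleIntegrable hg hj hz),
      mul_add]
  simp only [Finset.sum_congr rfl this, Finset.sum_add_distrib, hE z hz, hE' z hz]
  ring

lemma IsSplit.const_mul (a : ℂ) (hf : IsSplit c r S f) : IsSplit c r S (fun z => a * f z) := by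
  obtain ⟨hc, F, hF, hE⟩ := hf
  refine ⟨fun j hj => continuousOn_const.mul (hc j hj), fun z => a * F z, hF.const_smul a,
    fun z hz => ?_⟩
  simp only [mul_assoc a, circleIntegral.integral_const_mul]
  rw [hE z hz, mul_sub, Finset.mul_sum]
  congr 1
  exact Finset.sum_congr rfl fun j _ => by ring

lemma circleIntegral_eq_zero (h : FarDiscs c r) (j : ℕ) {z : ℂ} (hz : z ∈ slitCircle)
    (hf : ∀ w ∈ closedBall (c j) (r j), DifferentiableAt ℂ f w) :
    ∮ ζ in C(c j, r j), f ζ * (ζ - z)⁻¹ = 0 := by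
  have hd : ∀ ζ ∈ closedBall (c j) (r j), DifferentiableAt ℂ (fun ζ => f ζ * (ζ - z)⁻¹) ζ := by
    intro ζ hζ
    refine (hf ζ hζ).mul (DifferentiableAt.inv (by fun_prop) fun h0 => ?_)
    rw [sub_eq_zero.1 h0] at hζ
    exact h.notMem_closedBall j hz hζ
  exact Complex.circleIntegral_eq_zero_of_differentiable_on_off_countable (h.pos j).le
    Set.countable_empty (fun ζ hζ => (hd ζ hζ).continuousAt.continuousWithinAt)
    fun ζ hζ => hd ζ (ball_subset_closedBall hζ.1)

lemma isSplit_of_differentiableAt (h : FarDiscs c r)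
    (hf : ∀ w ∈ closedBall (0 : ℂ) 1, DifferentiableAt ℂ f w) : IsSplit c r S f := by
  refine ⟨fun j _ ζ hζ => (hf ζ (h.closedBall_subset j
    (sphere_subset_closedBall hζ))).continuousAt.continuousWithinAt, f,
    ⟨fun ζ hζ => (hf ζ (ball_subset_closedBall hζ)).differentiableWithinAt, ?_⟩, fun z hz => ?_⟩
  · rw [closure_ball _ one_ne_zero]
    exact fun ζ hζ => (hf ζ hζ).continuousAt.continuousWithinAt
  · rw [Finset.sum_eq_zero, sub_zero]
    intro j _
    rw [h.circleIntegral_eq_zero j hz fun w hw => hf w (h.closedBall_subset j hw), mul_zero]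

/-- Since `z` lies outside the circle, only the pole at `a` contributes. Partial fractions lower the
exponent by one at each step, and the leftover integral of `(ζ - a)⁻ᵏ` vanishes unless `k = 1`. -/
lemma circleIntegral_inv_pow (h : FarDiscs c r) {j : ℕ} {a z : ℂ} (ha : a ∈ ball (c j) (r j))
    (hz : z ∈ slitCircle) (m : ℕ) :
    ∮ ζ in C(c j, r j), ((ζ - a)⁻¹) ^ (m + 1) * (ζ - z)⁻¹ =
      -(2 * Real.pi * Complex.I) * ((z - a)⁻¹) ^ (m + 1) := by
  have hza : z - a ≠ 0 := fun h0 => h.notMem_closedBall j hz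
    (by rw [sub_eq_zero.1 h0]; exact ball_subset_closedBall ha)
  have hne : ∀ ζ ∈ sphere (c j) (r j), ζ - a ≠ 0 := fun ζ hζ h0 => by
    rw [sub_eq_zero.1 h0, mem_sphere] at hζ
    exact (mem_ball.1 ha).ne hζ
  have hne' : ∀ ζ ∈ sphere (c j) (r j), ζ - z ≠ 0 := fun ζ hζ h0 => by
    rw [sub_eq_zero.1 h0] at hζ
    exact h.notMem_closedBall j hz (sphere_subset_closedBall hζ)
  have hcont : ContinuousOn (fun ζ => (ζ - a)⁻¹) (sphere (c j) (r j)) :=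
    ContinuousOn.inv₀ (by fun_prop) hne
  have hcont' := (h.continuousOn_inv_sub j hz).mono sphere_subset_closedBall
  have key : ∀ m : ℕ, ∮ ζ in C(c j, r j), ((ζ - a)⁻¹) ^ (m + 1) * (ζ - z)⁻¹ =
      (z - a)⁻¹ * ((∮ ζ in C(c j, r j), ((ζ - a)⁻¹) ^ m * (ζ - z)⁻¹) -
        ∮ ζ in C(c j, r j), ((ζ - a)⁻¹) ^ (m + 1)) := by
    intro m
    have h1 : CircleIntegrable (fun ζ => ((ζ - a)⁻¹) ^ m * (ζ - z)⁻¹) (c j) (r j) :=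
      ((hcont.pow m).mul hcont').circleIntegrable (h.pos j).le
    have h2 : CircleIntegrable (fun ζ => ((ζ - a)⁻¹) ^ (m + 1)) (c j) (r j) :=
      (hcont.pow (m + 1)).circleIntegrable (h.pos j).le
    rw [← circleIntegral.integral_sub h1 h2, ← circleIntegral.integral_const_mul]
    refine circleIntegral.integral_congr (h.pos j).le fun ζ hζ => ?_
    have h1 := hne ζ hζ
    have h2 := hne' ζ hζ
    simp only [pow_succ]
    field_simp
    ring
  induction m with
  | zero =>
    rw [key]
    have h0 := h.circleIntegral_eq_zero (f := fun _ => 1) j hz fun w _ => by fun_prop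
    simp only [pow_zero, zero_add, pow_one, h0, circleIntegral.integral_sub_inv_of_mem_ball ha]
    ring
  | succ m ih =>
    have h0 : ∮ ζ in C(c j, r j), ((ζ - a)⁻¹) ^ (m + 1 + 1) = 0 := by
      rw [← circleIntegral.integral_sub_zpow_of_ne (n := -((m + 1 + 1 : ℕ) : ℤ))
        (by push_cast; omega) (c j) a (r j)]
      simp only [zpow_neg, zpow_natCast, inv_pow]
    rw [key, ih, h0]
    ring

/-- A positive power with its pole in a hole is recovered from that hole's Cauchy integral alone, so
`F = 0`; in the other cases the function is holomorphic near the closed disc and is its own `F`. -/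
lemma isSplit_inv_pow (h : FarDiscs c r) {a : ℂ}
    (ha : (∃ j ∈ S, a ∈ ball (c j) (r j)) ∨ a ∉ closedBall 0 1) (m : ℕ) :
    IsSplit c r S fun z => ((z - a)⁻¹) ^ m := by
  have hd : ∀ w, w ≠ a → DifferentiableAt ℂ (fun z => ((z - a)⁻¹) ^ m) w := fun w hw =>
    ((differentiableAt_id.sub_const a).inv (sub_ne_zero.2 hw)).pow m
  obtain ⟨i, hi, ha⟩ | ha := ha
  · cases m with
    | zero => exact h.isSplit_of_differentiableAt fun w _ => by simp
    | succ m =>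
    refine ⟨fun j _ ζ hζ => (hd ζ ?_).continuousAt.continuousWithinAt, 0,
      diffContOnCl_const, fun z hz => ?_⟩
    · rintro rfl
      exact (h.sphere_subset j hζ).2 (Set.mem_iUnion.2 ⟨i, ha⟩)
    · rw [Finset.sum_eq_single_of_mem i hi, h.circleIntegral_inv_pow ha hz]
      · have := Complex.two_pi_I_ne_zero
        rw [neg_mul, mul_neg, inv_mul_cancel_left₀ this]
        simp
      · intro j _ hji
        rw [h.circleIntegral_eq_zero j hz, mul_zero]
        intro w hw
        refine hd w ?_
        rintro rfl
        exact Set.disjoint_left.1 (h.disjoint j i hji) hw (ball_subset_closedBall ha)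
  · exact h.isSplit_of_differentiableAt fun w hw => hd w fun h0 => ha (h0 ▸ hw)

lemma isSplit_prod_inv (h : FarDiscs c r) (n : ℕ) : ∀ s : Multiset ℂ, s.card = n →
    (∀ a ∈ s, (∃ j ∈ S, a ∈ ball (c j) (r j)) ∨ a ∉ closedBall 0 1) →
    IsSplit c r S fun z => (s.map fun a => (z - a)⁻¹).prod := by
  induction n using Nat.strong_induction_on with
  | _ n ih =>
  intro s hn hs
  have hL : ∀ a ∈ s, a ∉ cheese c r := by
    rintro a ha ⟨h1, h2⟩
    obtain ⟨j, -, hj⟩ | h3 := hs a ha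
    · exact h2 (Set.mem_iUnion.2 ⟨j, hj⟩)
    · exact h3 h1
  induction s using Multiset.induction_on with
  | empty => simpa using h.isSplit_of_differentiableAt (f := fun _ => 1) fun w _ => by simp
  | cons a t _ =>
    by_cases hb : ∃ b ∈ t, b ≠ a
    -- Two distinct poles are separated by `1/((z-a)(z-b)) = (a-b)⁻¹ (1/(z-a) - 1/(z-b))`, leaving
    -- two products with one factor fewer; otherwise the product is a pure power.
    · obtain ⟨b, hb, hba⟩ := hb
      obtain ⟨u, rfl⟩ := Multiset.exists_cons_of_mem hb
      simp only [Multiset.card_cons] at hn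
      have h1 := ih (u.card + 1) (by omega) (a ::ₘ u) (by simp) fun x hx => hs x (by
        simp only [Multiset.mem_cons] at hx ⊢; tauto)
      have h2 := ih (u.card + 1) (by omega) (b ::ₘ u) (by simp) fun x hx => hs x (by
        simp only [Multiset.mem_cons] at hx ⊢; tauto)
      refine ((h1.const_mul (a - b)⁻¹).add h (h2.const_mul (-(a - b)⁻¹))).congr h fun z hz => ?_
      have hza : z - a ≠ 0 := fun h0 => hL a (by simp) (sub_eq_zero.1 h0 ▸ hz)
      have hzb : z - b ≠ 0 := fun h0 => hL b (by simp) (sub_eq_zero.1 h0 ▸ hz)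
      have hab : a - b ≠ 0 := sub_ne_zero.2 hba.symm
      simp only [Multiset.map_cons, Multiset.prod_cons]
      field_simp
      ring
    · push Not at hb
      rw [Multiset.eq_replicate_of_mem hb]
      simpa [pow_succ'] using h.isSplit_inv_pow (hs a (by simp)) (t.card + 1)

/-- Dividing `p` by `X - a` cancels one pole from the quotient part and leaves a constant numerator
for the remainder. -/
lemma isSplit_eval_mul_prod_inv (h : FarDiscs c r) (s : Multiset ℂ)
    (hs : ∀ a ∈ s, (∃ j ∈ S, a ∈ ball (c j) (r j)) ∨ a ∉ closedBall 0 1) (p : ℂ[X]) :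
    IsSplit c r S fun z => p.eval z * (s.map fun a => (z - a)⁻¹).prod := by
  induction s using Multiset.induction_on generalizing p with
  | empty => simpa using h.isSplit_of_differentiableAt (f := fun z => p.eval z) fun w _ =>
      p.differentiableAt
  | cons a t ih =>
    have h1 := ih (fun x hx => hs x (by simp [hx])) (p /ₘ (X - C a))
    have h2 := (h.isSplit_prod_inv _ _ rfl hs).const_mul (p.eval a)
    refine (h1.add h h2).congr h fun z hz => ?_
    have hza : z - a ≠ 0 := by
      intro h0
      obtain ⟨j, -, hj⟩ | h3 := hs a (by simp)
      · exact hz.2 (Set.mem_iUnion.2 ⟨j, sub_eq_zero.1 h0 ▸ hj⟩)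
      · exact h3 (sub_eq_zero.1 h0 ▸ hz.1)
    have hp : p.eval z = p.eval a + (z - a) * (p /ₘ (X - C a)).eval z := by
      conv_lhs => rw [← modByMonic_add_div p (X - C a), modByMonic_X_sub_C_eq_C_eval]
      simp
    simp only [Multiset.map_cons, Multiset.prod_cons, hp]
    field_simp
    ring

lemma exists_isSplit_div (h : FarDiscs c r) (p q : ℂ[X]) (hq : ∀ z ∈ cheese c r, q.eval z ≠ 0) :
    ∃ S : Finset ℕ, IsSplit c r S fun z => p.eval z / q.eval z := by
  have hroot : ∀ a ∈ q.roots, ∃ j : ℕ, a ∈ ball (c j) (r j) ∨ a ∉ closedBall 0 1 := by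
    intro a ha
    by_contra! hj
    refine hq a ⟨(hj 0).2, ?_⟩ (isRoot_of_mem_roots ha)
    simp only [Set.mem_iUnion, not_exists]
    exact fun j => (hj j).1
  choose! j hj using hroot
  refine ⟨q.roots.toFinset.image j, ?_⟩
  have h1 := (h.isSplit_eval_mul_prod_inv (S := q.roots.toFinset.image j) q.roots
    (fun a ha => (hj a ha).imp_left fun h1 =>
      ⟨j a, Finset.mem_image_of_mem _ (Multiset.mem_toFinset.2 ha), h1⟩) p).const_mul
      q.leadingCoeff⁻¹
  refine h1.congr h fun z _ => ?_
  have h2 : q.eval z = q.leadingCoeff * (q.roots.map fun a => z - a).prod := by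
    conv_lhs => rw [(IsAlgClosed.splits q).eq_prod_roots]
    simp [eval_multiset_prod, Multiset.map_map]
  simp only [h2, div_eq_mul_inv, mul_inv, ← Multiset.prod_map_inv]
  ring

end FarDiscs

/-! ### Cauchy estimates and a Harnack inequality on `[0, 1)`. -/

namespace FarDiscs

variable {c : ℕ → ℂ} {r : ℕ → ℝ}

/-- Length times maximum: the `+ 1` in `far` absorbs the radius, so the kernel is at most `(20 * 2 ^
j * r j)⁻¹` on the circle and `r j` cancels. -/
lemma norm_circleIntegral_le (h : FarDiscs c r) {f : ℂ → ℂ} (hf : ∀ z ∈ cheese c r, ‖f z‖ ≤ 1)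
    (j : ℕ) {z : ℂ} (hz : z ∈ slitCircle) :
    ‖(2 * Real.pi * Complex.I)⁻¹ * ∮ ζ in C(c j, r j), f ζ * (ζ - z)⁻¹‖ ≤
      (1 / 2) ^ j / 20 := by
  have hr := h.pos j
  have hpos : 0 < r j * (20 * 2 ^ j) := by positivity
  have hb : ∀ ζ ∈ sphere (c j) (r j), ‖f ζ * (ζ - z)⁻¹‖ ≤ (r j * (20 * 2 ^ j))⁻¹ := by
    intro ζ hζ
    rw [norm_mul, norm_inv]
    have h1 : r j * (20 * 2 ^ j) ≤ ‖ζ - z‖ := by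
      have h2 := h.far_sub j hz
      have h3 : ‖ζ - c j‖ = r j := by rw [← dist_eq_norm]; exact hζ
      have h4 : ‖z - c j‖ ≤ ‖ζ - z‖ + ‖ζ - c j‖ := by
        rw [norm_sub_rev ζ z]
        simpa using norm_add_le (z - ζ) (ζ - c j)
      linarith
    calc ‖f ζ‖ * ‖ζ - z‖⁻¹ ≤ 1 * (r j * (20 * 2 ^ j))⁻¹ := by
          gcongr
          exact hf ζ (h.sphere_subset j hζ)
      _ = _ := one_mul _
  have h1 := circleIntegral.norm_integral_le_of_norm_le_const hr.le hb
  have h2 : ‖(2 * Real.pi * Complex.I : ℂ)⁻¹‖ = (2 * Real.pi)⁻¹ := by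
    simp [abs_of_pos Real.pi_pos]
  rw [norm_mul, h2]
  have hpi := Real.pi_pos
  calc (2 * Real.pi)⁻¹ * _ ≤ (2 * Real.pi)⁻¹ * (2 * Real.pi * r j * (r j * (20 * 2 ^ j))⁻¹) := by
        gcongr
    _ = (1 / 2) ^ j / 20 := by
        rw [one_div, inv_pow]
        field_simp

/-- A rational function bounded by one on the cheese is close, on the unit circle and on `[0, 1]`,
to a function holomorphic in the disc. -/
lemma exists_approx (h : FarDiscs c r) (p q : ℂ[X]) (hq : ∀ z ∈ cheese c r, q.eval z ≠ 0)
    (hf : ∀ z ∈ cheese c r, ‖p.eval z / q.eval z‖ ≤ 1) :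
    ∃ F : ℂ → ℂ, DiffContOnCl ℂ F (ball 0 1) ∧
      ∀ z ∈ slitCircle, ‖F z - p.eval z / q.eval z‖ ≤ 1 / 10 := by
  obtain ⟨S, -, F, hF, hE⟩ := h.exists_isSplit_div p q hq
  refine ⟨F, hF, fun z hz => ?_⟩
  have h1 : p.eval z / q.eval z = _ := hE z hz
  rw [h1, sub_sub_cancel]
  calc _ ≤ ∑ j ∈ S, ((1 / 2 : ℝ) ^ j / 20) :=
        norm_sum_le_of_le _ fun j _ => h.norm_circleIntegral_le hf j hz
    _ = (∑ j ∈ S, (1 / 2 : ℝ) ^ j) / 20 := by rw [Finset.sum_div]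
    _ ≤ 2 / 20 := by
        gcongr
        exact (summable_geometric_two.sum_le_tsum S fun _ _ => by positivity).trans_eq
          tsum_geometric_two
    _ = 1 / 10 := by norm_num

lemma ofReal_mem_slitCircle {x : ℝ} (h0 : 0 ≤ x) (h1 : x ≤ 1) : (x : ℂ) ∈ slitCircle :=
  Or.inr ⟨x, ⟨h0, h1⟩, rfl⟩

/-- Here `|F| ≤ 11/10` on the disc by the maximum principle, and `|F x| ≤ 1/10`. The Schwarz lemma
on the disc of radius `1 - x` about `x` gives `|F y - F x| ≤ 6/10`; adding `|F x|` and the error at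
`y` gives at most `8/10`. -/
lemma norm_div_le_of_eval_eq_zero (h : FarDiscs c r) (p q : ℂ[X])
    (hq : ∀ z ∈ cheese c r, q.eval z ≠ 0)
    (hf : ∀ z ∈ cheese c r, ‖p.eval z / q.eval z‖ ≤ 1) {x y : ℝ} (hx : 0 ≤ x) (hx1 : x < 1)
    (hxy : x ≤ y) (hy : y ≤ (1 + x) / 2) (hp : p.eval (x : ℂ) = 0) :
    ‖p.eval (y : ℂ) / q.eval (y : ℂ)‖ ≤ 9 / 10 := by
  obtain ⟨F, hF, hE⟩ := h.exists_approx p q hq hf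
  have hx' := hE x (ofReal_mem_slitCircle hx hx1.le)
  have hy' := hE y (ofReal_mem_slitCircle (hx.trans hxy) (by linarith))
  rw [hp, zero_div, sub_zero] at hx'
  have hbd : ∀ z ∈ closedBall (0 : ℂ) 1, ‖F z‖ ≤ 11 / 10 := by
    intro z hz
    rw [← closure_ball (0 : ℂ) one_ne_zero] at hz
    refine Complex.norm_le_of_forall_mem_frontier_norm_le isBounded_ball hF (fun w hw => ?_) hz
    rw [frontier_ball _ one_ne_zero] at hw
    have h1 := hE w (Or.inl hw)
    have h2 := hf w (h.slitCircle_subset (Or.inl hw))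
    have h3 := norm_add_le (F w - p.eval w / q.eval w) (p.eval w / q.eval w)
    rw [sub_add_cancel] at h3
    linarith
  have hsub : ball (x : ℂ) (1 - x) ⊆ ball 0 1 := by
    refine ball_subset_ball' ?_
    rw [dist_zero_right, Complex.norm_real, Real.norm_of_nonneg hx]
    linarith
  have hmaps : Set.MapsTo F (ball (x : ℂ) (1 - x)) (closedBall (F x) (12 / 10)) := by
    intro z hz
    rw [mem_closedBall, dist_eq_norm]
    have := hbd z (ball_subset_closedBall (hsub hz))
    have := norm_sub_le (F z) (F x)
    linarith
  have hdist : dist (y : ℂ) x = y - x := by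
    rw [dist_eq_norm, ← Complex.ofReal_sub, Complex.norm_real,
      Real.norm_of_nonneg (sub_nonneg.2 hxy)]
  have hs := Complex.dist_le_div_mul_dist_of_mapsTo_ball (hF.differentiableOn.mono hsub) hmaps
    (z := (y : ℂ)) (by rw [mem_ball, hdist]; linarith)
  rw [hdist, dist_eq_norm] at hs
  have h1 : 12 / 10 / (1 - x) * (y - x) ≤ 6 / 10 := by
    rw [div_mul_eq_mul_div, div_le_iff₀ (by linarith)]
    linarith
  have h2 : p.eval (y : ℂ) / q.eval (y : ℂ) =
      (F y - F x) + F x - (F y - p.eval (y : ℂ) / q.eval (y : ℂ)) := by ring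
  rw [h2]
  refine (norm_sub_le _ _).trans ?_
  have := norm_add_le (F y - F x) (F x)
  linarith

/-- Both moduli involve the same imaginary part up to sign, so the bound passes to real parts; 19 is
`(1 + 9/10) / (1 - 9/10)`. -/
lemma re_le_of_norm_div_le {a b : ℂ} (ha : 0 < a.re) (hb : 0 ≤ b.re)
    (h : ‖(b - a) / (b + starRingEnd ℂ a)‖ ≤ 9 / 10) : a.re ≤ 19 * b.re := by
  have hne : b + starRingEnd ℂ a ≠ 0 := fun h0 => by
    have := congrArg Complex.re h0
    simp at this
    linarith
  rw [norm_div, div_le_iff₀ (norm_pos_iff.2 hne)] at h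
  have h1 : ‖b - a‖ ^ 2 ≤ (9 / 10) ^ 2 * ‖b + starRingEnd ℂ a‖ ^ 2 := by
    rw [← mul_pow]
    gcongr
  rw [← Complex.normSq_eq_norm_sq, ← Complex.normSq_eq_norm_sq, Complex.normSq_apply,
    Complex.normSq_apply] at h1
  simp only [Complex.sub_re, Complex.sub_im, Complex.add_re, Complex.add_im, Complex.conj_re,
    Complex.conj_im] at h1
  have h2 : (a.re - b.re) ^ 2 ≤ (9 / 10 * (a.re + b.re)) ^ 2 := by
    nlinarith [sq_nonneg (b.im - a.im)]
  have h3 := (abs_le.1 (abs_le_of_sq_le_sq h2 (by linarith))).2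
  linarith

/-- A Harnack inequality for nearby points of `[0, 1)`. -/
lemma re_le_of_near (h : FarDiscs c r) (p q : ℂ[X]) (hq : ∀ z ∈ cheese c r, q.eval z ≠ 0)
    (hre : ∀ z ∈ cheese c r, 0 ≤ (p.eval z / q.eval z).re) {x y : ℝ} (hx : 0 ≤ x) (hx1 : x < 1)
    (hxy : x ≤ y) (hy : y ≤ (1 + x) / 2) :
    (p.eval (x : ℂ) / q.eval (x : ℂ)).re ≤ 19 * (p.eval (y : ℂ) / q.eval (y : ℂ)).re := by
  have hxL := h.slitCircle_subset (ofReal_mem_slitCircle hx hx1.le)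
  have hyL := h.slitCircle_subset (ofReal_mem_slitCircle (hx.trans hxy) (by linarith : y ≤ 1))
  set a : ℂ := p.eval (x : ℂ) / q.eval (x : ℂ) with ha
  rcases (hre x hxL).eq_or_lt with h0 | h0
  · rw [ha, ← h0]
    linarith [hre y hyL]
  have hne : ∀ z ∈ cheese c r, p.eval z / q.eval z + starRingEnd ℂ a ≠ 0 := by
    intro z hz hz0
    have h1 := congrArg Complex.re hz0
    have h2 := hre z hz
    rw [Complex.add_re, Complex.conj_re, Complex.zero_re] at h1
    linarith
  -- The Cayley transform `(g - a) / (g + conj a)` of `g = p / q` is again rational without poles on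
  -- the cheese, is bounded by one, and vanishes at `x`.
  have hq' : ∀ z ∈ cheese c r, (p + C (starRingEnd ℂ a) * q).eval z ≠ 0 := by
    intro z hz hz0
    refine hne z hz ?_
    have := hq z hz
    simp only [eval_add, eval_mul, eval_C] at hz0
    field_simp
    linear_combination hz0
  have heq : ∀ z ∈ cheese c r, (p - C a * q).eval z / (p + C (starRingEnd ℂ a) * q).eval z =
      (p.eval z / q.eval z - a) / (p.eval z / q.eval z + starRingEnd ℂ a) := by
    intro z hz
    have h1 := hq z hz
    simp only [eval_add, eval_sub, eval_mul, eval_C]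
    rw [div_sub' h1, div_add' _ _ _ h1, div_div_div_cancel_right₀ h1, mul_comm (q.eval z) a]
  have hbd : ∀ z ∈ cheese c r,
      ‖(p - C a * q).eval z / (p + C (starRingEnd ℂ a) * q).eval z‖ ≤ 1 := by
    intro z hz
    rw [heq z hz, norm_div]
    refine div_le_one_of_le₀ ?_ (norm_nonneg _)
    refine le_of_sq_le_sq ?_ (norm_nonneg _)
    rw [← Complex.normSq_eq_norm_sq, ← Complex.normSq_eq_norm_sq, Complex.normSq_apply,
      Complex.normSq_apply]
    simp only [Complex.sub_re, Complex.sub_im, Complex.add_re, Complex.add_im, Complex.conj_re,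
      Complex.conj_im]
    nlinarith [mul_nonneg (hre z hz) h0.le]
  have hb := h.norm_div_le_of_eval_eq_zero _ _ hq' hbd hx hx1 hxy hy (by
    simp only [eval_sub, eval_mul, eval_C]
    rw [ha, div_mul_cancel₀ _ (hq x hxL), sub_self])
  rw [heq y hyL] at hb
  exact re_le_of_norm_div_le h0 (hre y hyL) hb

lemma re_zero_le (h : FarDiscs c r) (p q : ℂ[X]) (hq : ∀ z ∈ cheese c r, q.eval z ≠ 0)
    (hre : ∀ z ∈ cheese c r, 0 ≤ (p.eval z / q.eval z).re) (n : ℕ) :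
    ∀ y : ℝ, 0 ≤ y → y ≤ 1 - (1 / 2) ^ n →
      (p.eval 0 / q.eval 0).re ≤ 19 ^ n * (p.eval (y : ℂ) / q.eval (y : ℂ)).re := by
  induction n with
  | zero =>
    intro y hy hy'
    obtain rfl : y = 0 := le_antisymm (by simpa using hy') hy
    simp
  | succ n ih =>
    intro y hy hy'
    have hpow : (0 : ℝ) < (1 / 2) ^ n := by positivity
    have hpow' : (1 / 2 : ℝ) ^ n ≤ 1 := pow_le_one₀ (by norm_num) (by norm_num)
    -- One Harnack step halves the distance to 1, so this `x` is in range of the induction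
    -- hypothesis and `y` is within one step of it.
    set x : ℝ := min y (1 - (1 / 2) ^ n)
    have hx0 : 0 ≤ x := le_min hy (by linarith)
    have hx1 : x ≤ 1 - (1 / 2) ^ n := min_le_right _ _
    have hyx : y ≤ (1 + x) / 2 := by
      rw [pow_succ] at hy'
      rcases min_choice y (1 - (1 / 2 : ℝ) ^ n) with hx | hx
      · have : x = y := hx
        rw [this] at hx1 ⊢
        linarith
      · have : x = 1 - (1 / 2) ^ n := hx
        rw [this]
        linarith
    refine (ih x hx0 hx1).trans ?_
    rw [pow_succ, mul_assoc]
    gcongr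
    exact h.re_le_of_near p q hq hre hx0 (by linarith) (min_le_left _ _) hyx

end FarDiscs

/-! ### Construction of the holes. -/

lemma isClosed_slitCircle : IsClosed slitCircle :=
  isClosed_sphere.union (isCompact_Icc.image Complex.continuous_ofReal).isClosed

lemma interior_slitCircle : interior slitCircle = ∅ := by
  have h : interior ((fun t : ℝ => (t : ℂ)) '' Set.Icc 0 1) = ∅ := by
    rw [Set.eq_empty_iff_forall_notMem]
    intro z hz
    obtain ⟨ε, hε, hb⟩ := Metric.mem_nhds_iff.1 (mem_interior_iff_mem_nhds.1 hz)
    obtain ⟨s, -, hs⟩ := hb (mem_ball_self hε)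
    obtain ⟨t, -, ht⟩ := hb (show z + (ε / 2 : ℝ) * Complex.I ∈ ball z ε by
      rw [mem_ball, dist_eq_norm, add_sub_cancel_left, norm_mul, Complex.norm_I, mul_one,
        Complex.norm_real, Real.norm_of_nonneg (by positivity)]
      linarith)
    have h1 := congrArg Complex.im hs
    have h2 := congrArg Complex.im ht
    simp at h1 h2
    linarith
  rw [slitCircle, interior_union_isClosed_of_interior_empty isClosed_sphere h,
    interior_sphere _ one_ne_zero]

lemma IsOpen.exists_mem_notMem_slitCircle {U : Set ℂ} (hU : IsOpen U) (hne : U.Nonempty) :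
    ∃ z ∈ U, z ∉ slitCircle := by
  by_contra! h
  have h1 := hU.subset_interior_iff.2 h
  rw [interior_slitCircle] at h1
  exact hne.ne_empty (Set.subset_empty_iff.1 h1)

/-- One step of the construction of the discs: a new disc avoiding a given closed set `K`, centred
at a prescribed point `u` if possible. -/
lemma exists_disc_avoiding {K : Set ℂ} (hK : IsClosed K) (hKE : Disjoint K slitCircle) (u : ℂ)
    (n : ℕ) : ∃ c : ℂ, ∃ r : ℝ, 0 < r ∧ ball c r ⊆ ball 0 1 ∧ Disjoint K (closedBall c r) ∧
      (∀ z ∈ slitCircle, r * (20 * 2 ^ n + 1) ≤ ‖z - c‖) ∧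
      (u ∈ ball (0 : ℂ) 1 → u ∉ slitCircle → u ∉ K → c = u) := by
  have hO : IsOpen (ball (0 : ℂ) 1 ∩ slitCircleᶜ ∩ Kᶜ) :=
    (isOpen_ball.inter isClosed_slitCircle.isOpen_compl).inter hK.isOpen_compl
  obtain ⟨c, hc, hcu⟩ : ∃ c ∈ ball (0 : ℂ) 1 ∩ slitCircleᶜ ∩ Kᶜ,
      u ∈ ball (0 : ℂ) 1 → u ∉ slitCircle → u ∉ K → c = u := by
    by_cases hu : u ∈ ball (0 : ℂ) 1 ∩ slitCircleᶜ ∩ Kᶜ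
    · exact ⟨u, hu, fun _ _ _ => rfl⟩
    -- If `u` is unusable, any point near 0 off the slit serves: `K` is closed and misses 0.
    · have h0 : (0 : ℂ) ∈ slitCircle := Or.inr ⟨0, by simp, by simp⟩
      obtain ⟨c, hc, hcE⟩ := (isOpen_ball.inter hK.isOpen_compl).exists_mem_notMem_slitCircle
        ⟨0, mem_ball_self (one_pos), fun h => Set.disjoint_left.1 hKE h h0⟩
      exact ⟨c, ⟨⟨hc.1, hcE⟩, hc.2⟩, fun h1 h2 h3 => (hu ⟨⟨h1, h2⟩, h3⟩).elim⟩
  obtain ⟨ε, hε, hb⟩ := Metric.isOpen_iff.1 hO c hc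
  have hr : 0 < ε / (20 * 2 ^ n + 1) := by positivity
  have hrε : ε / (20 * 2 ^ n + 1) < ε := by
    rw [div_lt_iff₀ (by positivity)]
    have : 0 < ε * (20 * 2 ^ n) := by positivity
    linarith
  refine ⟨c, ε / (20 * 2 ^ n + 1), hr, fun z hz => (hb (ball_subset_ball hrε.le hz)).1.1, ?_,
    fun z hz => ?_, hcu⟩
  · exact Set.disjoint_right.2 fun z hz => (hb (closedBall_subset_ball hrε hz)).2
  · rw [div_mul_cancel₀ _ (by positivity), ← dist_eq_norm]
    by_contra! hlt
    exact (hb hlt).1.2 hz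

/-- There are discs with small radii such that the resulting cheese has empty interior. -/
lemma exists_farDiscs :
    ∃ (c : ℕ → ℂ) (r : ℕ → ℝ), FarDiscs c r ∧ interior (cheese c r) = ∅ := by
  have step : ∀ (K : {K : Set ℂ // IsClosed K ∧ Disjoint K slitCircle}) (n : ℕ),
      ∃ d : ℂ × ℝ, 0 < d.2 ∧ ball d.1 d.2 ⊆ ball 0 1 ∧ Disjoint K.1 (closedBall d.1 d.2) ∧
        (∀ z ∈ slitCircle, d.2 * (20 * 2 ^ n + 1) ≤ ‖z - d.1‖) ∧
        (TopologicalSpace.denseSeq ℂ n ∈ ball (0 : ℂ) 1 →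
          TopologicalSpace.denseSeq ℂ n ∉ slitCircle →
          TopologicalSpace.denseSeq ℂ n ∉ K.1 → d.1 = TopologicalSpace.denseSeq ℂ n) := by
    intro K n
    obtain ⟨c, r, h⟩ := exists_disc_avoiding K.2.1 K.2.2 (TopologicalSpace.denseSeq ℂ n) n
    exact ⟨(c, r), h⟩
  choose d hpos hsub hdisj hfar hdense using step
  have hnext : ∀ K n, IsClosed (K.1 ∪ closedBall (d K n).1 (d K n).2) ∧
      Disjoint (K.1 ∪ closedBall (d K n).1 (d K n).2) slitCircle := by
    intro K n
    refine ⟨K.2.1.union isClosed_closedBall, K.2.2.union_left ?_⟩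
    refine Set.disjoint_right.2 fun z hz hz' => ?_
    have h1 := hfar K n z hz
    have h2 : 0 < (d K n).2 * (20 * 2 ^ n) := mul_pos (hpos K n) (by positivity)
    rw [mem_closedBall, dist_eq_norm] at hz'
    linarith
  -- `K n` is the union of the first `n` closed discs.
  let K : ℕ → {K : Set ℂ // IsClosed K ∧ Disjoint K slitCircle} :=
    Nat.rec ⟨∅, isClosed_empty, Set.empty_disjoint _⟩ fun n K => ⟨_, hnext K n⟩
  have hKsucc : ∀ n, (K (n + 1)).1 = (K n).1 ∪ closedBall (d (K n) n).1 (d (K n) n).2 :=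
    fun n => rfl
  have hmono : Monotone fun n => (K n).1 :=
    monotone_nat_of_le_succ fun n => by rw [hKsucc]; exact Set.subset_union_left
  have hmem : ∀ n, ∀ z ∈ (K n).1, ∃ i, z ∈ closedBall (d (K i) i).1 (d (K i) i).2 := by
    intro n
    induction n with
    | zero => exact fun z hz => hz.elim
    | succ n ih =>
      intro z hz
      rw [hKsucc] at hz
      exact hz.elim (ih z) fun h => ⟨n, h⟩
  have hlt : ∀ i j, i < j → Disjoint (closedBall (d (K i) i).1 (d (K i) i).2)
      (closedBall (d (K j) j).1 (d (K j) j).2) := by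
    intro i j hij
    refine (hdisj (K j) j).mono_left (Set.Subset.trans ?_ (hmono (Nat.succ_le_of_lt hij)))
    simp only [Nat.succ_eq_add_one, hKsucc]
    exact Set.subset_union_right
  refine ⟨fun n => (d (K n) n).1, fun n => (d (K n) n).2,
    ⟨fun j => hpos _ _, fun j => hsub _ _, fun i j hij => ?_, fun j => hfar _ _⟩, ?_⟩
  · exact hij.lt_or_gt.elim (hlt i j) fun h => (hlt j i h).symm
  · by_contra! hne
    obtain ⟨z, hz⟩ := hne
    have hint : interior (cheese (fun n => (d (K n) n).1) fun n => (d (K n) n).2) ⊆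
        ball (0 : ℂ) 1 := by
      rw [← interior_closedBall (0 : ℂ) one_ne_zero]
      exact interior_mono Set.sdiff_subset
    obtain ⟨w, hw, hwE⟩ := isOpen_interior.exists_mem_notMem_slitCircle ⟨z, hz⟩
    obtain ⟨u, ⟨hu, huE⟩, n, rfl⟩ := (TopologicalSpace.denseRange_denseSeq ℂ).inter_open_nonempty _
      (isOpen_interior.inter isClosed_slitCircle.isOpen_compl) ⟨w, hw, hwE⟩
    obtain ⟨i, hi⟩ : ∃ i, TopologicalSpace.denseSeq ℂ n ∈
        closedBall (d (K i) i).1 (d (K i) i).2 := by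
      by_cases hK : TopologicalSpace.denseSeq ℂ n ∈ (K n).1
      · exact hmem n _ hK
      · refine ⟨n, ?_⟩
        rw [hdense (K n) n (hint hu) huE hK]
        exact mem_closedBall_self (hpos _ _).le
    -- The dense point may lie on the boundary of a hole, but the open interior then meets the open
    -- hole itself.
    rw [← closure_ball _ (hpos (K i) i).ne'] at hi
    obtain ⟨v, hv, hvi⟩ := mem_closure_iff.1 hi _ isOpen_interior hu
    exact (interior_subset hv).2 (Set.mem_iUnion.2 ⟨i, hvi⟩)

/-! ### From Harnack to the norm in the dual space. -/

namespace FarDiscs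

variable {c : ℕ → ℂ} {r : ℕ → ℝ}

lemma norm_sub_le_of_mem_rationalSubalgebra (h : FarDiscs c r) {L : TopologicalSpace.Compacts ℂ}
    (hL : (L : Set ℂ) = cheese c r) (n : ℕ) {y : ℝ} (hy : 0 ≤ y) (hyn : y ≤ 1 - (1 / 2) ^ n)
    (x₀ x₁ : L) (hx₀ : (x₀ : ℂ) = 0) (hx₁ : (x₁ : ℂ) = y) {f : C(L, ℂ)}
    (hf : f ∈ rationalSubalgebra L) :
    ‖f x₀ - f x₁‖ ≤ 2 * (1 - (19 ^ n)⁻¹) * ‖f‖ := by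
  obtain ⟨p, q, hq, hpq⟩ := hf
  have hmem : ∀ z, z ∈ cheese c r ↔ z ∈ L := fun z => by rw [← hL]; rfl
  have hq' : ∀ z ∈ cheese c r, q.eval z ≠ 0 := fun z hz => hq z ((hmem z).1 hz)
  -- Rotating by `u` makes the difference real, and `‖f‖ + u f` has nonnegative real part, so the
  -- chained Harnack inequality applies to it.
  obtain ⟨u, hu, huf⟩ : ∃ u : ℂ, ‖u‖ = 1 ∧ u * (f x₀ - f x₁) = ‖f x₀ - f x₁‖ := by
    by_cases h0 : f x₀ - f x₁ = 0
    · exact ⟨1, by simp, by simp [h0]⟩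
    · have hn : ((‖f x₀ - f x₁‖ : ℝ) : ℂ) ≠ 0 := by simpa using h0
      refine ⟨‖f x₀ - f x₁‖ / (f x₀ - f x₁), ?_, div_mul_cancel₀ _ h0⟩
      rw [norm_div, Complex.norm_real, norm_norm, div_self (by simpa using h0)]
  have heq : ∀ z (hz : z ∈ L), (C (‖f‖ : ℂ) * q + C u * p).eval z / q.eval z =
      ‖f‖ + u * f ⟨z, hz⟩ := by
    intro z hz
    have := hq z hz
    rw [hpq ⟨z, hz⟩]
    simp only [eval_add, eval_mul, eval_C]
    field_simp
  have hbd : ∀ x : L, |(u * f x).re| ≤ ‖f‖ := fun x => by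
    refine (Complex.abs_re_le_norm _).trans ?_
    rw [norm_mul, hu, one_mul]
    exact f.norm_coe_le_norm x
  have key := h.re_zero_le (C (‖f‖ : ℂ) * q + C u * p) q hq' (fun z hz => by
    rw [heq z ((hmem z).1 hz), Complex.add_re, Complex.ofReal_re]
    linarith [(abs_le.1 (hbd ⟨z, (hmem z).1 hz⟩)).1]) n y hy hyn
  rw [← hx₀, ← hx₁, heq _ x₀.2, heq _ x₁.2] at key
  simp only [Complex.add_re, Complex.ofReal_re, Subtype.coe_eta] at key
  have h1 : (u * f x₀).re - (u * f x₁).re = ‖f x₀ - f x₁‖ := by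
    rw [← Complex.sub_re, ← mul_sub, huf, Complex.ofReal_re]
  have hM : (0 : ℝ) < 19 ^ n := by positivity
  have hM1 : ((19 : ℝ) ^ n)⁻¹ ≤ 1 := inv_le_one_of_one_le₀ (one_le_pow₀ (by norm_num))
  have h2 : (19 ^ n)⁻¹ * (‖f‖ + (u * f x₀).re) ≤ ‖f‖ + (u * f x₁).re := by
    rwa [inv_mul_le_iff₀ hM]
  have h3 := mul_le_mul_of_nonneg_left (abs_le.1 (hbd x₀)).2 (sub_nonneg.2 hM1)
  linarith

lemma norm_sub_le_of_mem_rationalAlgebra (h : FarDiscs c r) {L : TopologicalSpace.Compacts ℂ}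
    (hL : (L : Set ℂ) = cheese c r) (n : ℕ) {y : ℝ} (hy : 0 ≤ y) (hyn : y ≤ 1 - (1 / 2) ^ n)
    (x₀ x₁ : L) (hx₀ : (x₀ : ℂ) = 0) (hx₁ : (x₁ : ℂ) = y) {f : C(L, ℂ)}
    (hf : f ∈ rationalAlgebra L) :
    ‖f x₀ - f x₁‖ ≤ 2 * (1 - (19 ^ n)⁻¹) * ‖f‖ := by
  have hcl : IsClosed {f : C(L, ℂ) | ‖f x₀ - f x₁‖ ≤ 2 * (1 - (19 ^ n)⁻¹) * ‖f‖} :=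
    isClosed_le (((continuous_eval_const x₀).sub
      (continuous_eval_const x₁)).norm) (continuous_const.mul continuous_norm)
  exact closure_minimal (fun f hf =>
    h.norm_sub_le_of_mem_rationalSubalgebra hL n hy hyn x₀ x₁ hx₀ hx₁ hf) hcl hf

lemma gleasonRel (h : FarDiscs c r) {L : TopologicalSpace.Compacts ℂ}
    (hL : (L : Set ℂ) = cheese c r) {y : ℝ} (hy : 0 ≤ y) (hy1 : y < 1)
    (x₀ x₁ : L) (hx₀ : (x₀ : ℂ) = 0) (hx₁ : (x₁ : ℂ) = y) :
    GleasonRel (rationalAlgebra L) (evalChar _ x₀) (evalChar _ x₁) := by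
  obtain ⟨n, hn⟩ := exists_pow_lt_of_lt_one (sub_pos.2 hy1) (by norm_num : (1 / 2 : ℝ) < 1)
  have hM1 : ((19 : ℝ) ^ n)⁻¹ ≤ 1 := inv_le_one_of_one_le₀ (one_le_pow₀ (by norm_num))
  refine (ContinuousLinearMap.opNorm_le_bound _ (by linarith : 0 ≤ 2 * (1 - ((19 : ℝ) ^ n)⁻¹))
    fun f => ?_).trans_lt (by
      have : (0 : ℝ) < (19 ^ n)⁻¹ := by positivity
      linarith)
  exact h.norm_sub_le_of_mem_rationalAlgebra hL n hy (by linarith) x₀ x₁ hx₀ hx₁ f.2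

lemma isCompact_cheese : IsCompact (cheese c r) :=
  (isCompact_closedBall 0 1).diff (isOpen_iUnion fun _ => isOpen_ball)

end FarDiscs

theorem theorem4p6 :
    ∃ L : TopologicalSpace.Compacts ℂ, IsSwissCheese (L : Set ℂ) ∧
      ∃ P : Set (WeakDual.characterSpace ℂ (rationalAlgebra L)),
        IsGleasonPart (rationalAlgebra L) P ∧
        ∀ t : ℝ, t ∈ Set.Ico (0 : ℝ) 1 →
          ∃ h : (t : ℂ) ∈ L, evalChar (rationalAlgebra L) ⟨(t : ℂ), h⟩ ∈ P := by
  obtain ⟨c, r, h, hint⟩ := exists_farDiscs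
  have hmem : ∀ t : ℝ, 0 ≤ t → t < 1 → (t : ℂ) ∈ cheese c r := fun t h0 h1 =>
    h.slitCircle_subset (FarDiscs.ofReal_mem_slitCircle h0 h1.le)
  have h0 : (0 : ℂ) ∈ cheese c r := by simpa using hmem 0 le_rfl one_pos
  refine ⟨⟨cheese c r, FarDiscs.isCompact_cheese⟩,
    ⟨c, r, h.pos, h.subset, h.disjoint, h.summable, rfl, hint⟩, _,
    ⟨evalChar _ ⟨0, h0⟩, rfl⟩, fun t ht => ⟨hmem t ht.1 ht.2, ?_⟩⟩
  exact h.gleasonRel rfl ht.1 ht.2 _ _ rfl rfl
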